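/- Let $n_{\max}\ge 2$. The logic $\mathcal{DLR}_{reg}$ (with maximal arity $n_{\max}$) has concepts $C$, relations $R$ of arity $n\in\{2,\dots,n_{\max}\}$ and regular expressions $E$ given by $$C::=\top_1\mid A\mid\neg C\mid C_1\sqcap C_2\mid\exists E.C\mid\exists[i]R\mid(\le k\,[i]R),$$ $$R::=\top_n\mid P\mid(i/n:C)\mid\neg R\mid R_1\sqcap R_2,\qquad E::=\varepsilon\mid R|_{i,j}\mid E_1\circ E_2\mid E_1\sqcup E_2\mid E^*,$$ where $A$ and $P$ are atomic concepts and atomic relations, $k\ge 0$, and $i,j$ denote components of $R$ (or, in $(i/n:C)$, $1\le i\le n$). In an interpretation with nonempty domain $\Delta$, $\top_1$ denotes $\Delta$, $A$ a subset of $\Delta$, $\top_n$ a subset of $\Delta^n$, and an atomic $P$ of arity $n$ a subset of $\top_n^{\mathcal I}$; $\neg$ and $\sqcap$ are complement and intersection (complement within $\top_n^{\mathcal I}$ for relations of arity $n$); $\exists E.C$ is the set of $d$ having an $E$-successor in $C$; $\exists[i]R$, respectively $(\le k\,[i]R)$, is the set of $d$ that are the $i$-th component of at least one, respectively at most $k$,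 tuples of $R$; $(i/n:C)$ is the set of tuples of $\top_n^{\mathcal I}$ whose $i$-th component is in $C$; $\varepsilon$ is the identity, $R|_{i,j}$ is the set of pairs $(x_i,x_j)$ with $(x_1,\dots,x_n)\in R$, and $\circ,\sqcup,{}^*$ are composition, union and reflexive transitive closure. Distinct constants denote distinct elements of $\Delta$. A schema $\mathcal S$ is a finite set of assertions $C_1\sqsubseteq C_2$ and $R_1\sqsubseteq R_2$ ($R_1,R_2$ of equal arity), and its models are the interpretations in which the corresponding inclusions hold. A query with inequalities is a finite nonempty disjunction of nonempty finite conjunctions of atoms $C(t)$, $R(t_1,\dots,t_n)$, $t\neq t'$, whose terms are constants, distinguished variables $x_1,\dots,x_a$ (each appearing in every disjunct), or other variables; $a\ge 0$ is its arity. Given an interpretation $\mathcal I$, $q^{\mathcal I}\subseteq\Delta^a$ is the set of values of $(x_1,\dots,x_a)$ for which some disjunct is true for some values of its other variables. Write $\mathcal S\models q\subseteq q'$ if $q^{\mathcal I}\subseteq q'^{\mathcal I}$ for every model $\mathcal I$ of $\mathcal S$ (interpreting a given finite set of constants that contains those used in the queries). **Theorem 4.2.** The query containment problem, i.e. given a schema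 $\mathcal S$, a finite set of constants and two queries $q,q'$ of the same arity that may contain atoms $t\ne t'$, decide whether $\mathcal S\models q\subseteq q'$, is undecidable. It remains undecidable when restricted to inputs such that: every assertion of $\mathcal S$ is of the form $A\sqsubseteq C$ with $A$ an atomic concept; $\mathcal S,q,q'$ contain no regular expressions; $q$ and $q'$ contain no union (each is a single conjunction) and there are no constants; and $q'$ contains exactly one inequality and $q$ none. More precisely, in both cases no computable predicate on natural numbers gives the correct answer on the Gödel numbers of all inputs of the class. -/

import Mathlib

namespace DLR

/-! ### Syntax

The maximal arity `N` of the language is a parameter.  Well-typedness is built into the syntax: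
a relation expression of arity `n` is an element of `Rel N n`, and a component of it is an element
of `Fin n` (the component written `i + 1` in the usual 1-based notation is `i : Fin n`).
Atomic concepts are named by natural numbers, and so are, for each arity, the atomic relations. -/

/-- Arities of relations: the integers between `2` and the maximal arity `N`. -/
abbrev Arity (N : ℕ) : Type := {n : ℕ // 2 ≤ n ∧ n ≤ N}

mutual

/-- Concept expressions. -/
inductive Concept (N : ℕ) : Type
  /-- the concept denoting the whole domain -/
  | top : Concept N
  | atom (A : ℕ) : Concept N
  | neg (C : Concept N) : Concept N
  | inf (C₁ C₂ : Concept N) : Concept N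
  /-- `∃E.C` -/
  | ex (E : RegExp N) (C : Concept N) : Concept N
  /-- `∃[i]R` -/
  | exComp (n : Arity N) (i : Fin n.1) (R : Rel N n) : Concept N
  /-- `(≤ k [i]R)` -/
  | atMost (k : ℕ) (n : Arity N) (i : Fin n.1) (R : Rel N n) : Concept N

/-- Relation expressions, indexed by their arity. -/
inductive Rel (N : ℕ) : Arity N → Type
  /-- the relation covering all relations of arity `n` -/
  | top (n : Arity N) : Rel N n
  | atom (n : Arity N) (P : ℕ) : Rel N n
  /-- `(i/n : C)` -/
  | comp (n : Arity N) (i : Fin n.1) (C : Concept N) : Rel N n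
  | neg (n : Arity N) (R : Rel N n) : Rel N n
  | inf (n : Arity N) (R₁ R₂ : Rel N n) : Rel N n

/-- Regular expressions over binary projections of relations. -/
inductive RegExp (N : ℕ) : Type
  | eps : RegExp N
  /-- the projection of `R` on its components `i` and `j` -/
  | proj (n : Arity N) (R : Rel N n) (i j : Fin n.1) : RegExp N
  | comp (E₁ E₂ : RegExp N) : RegExp N
  | union (E₁ E₂ : RegExp N) : RegExp N
  | star (E : RegExp N) : RegExp N

end

/-- Assertions: inclusions between concepts, or between relations of the same arity. -/
inductive Assertion (N : ℕ) : Type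
  | concept (C₁ C₂ : Concept N) : Assertion N
  | rel (n : Arity N) (R₁ R₂ : Rel N n) : Assertion N

/-- A schema is a finite collection of assertions. -/
abbrev Schema (N : ℕ) : Type := List (Assertion N)

/-- Terms of a query of arity `a` over `c` constants: the distinguished variables `x₁, …, xₐ`,
the existential variables (named by natural numbers), and the constants. -/
inductive Term (c a : ℕ) : Type
  | head (i : Fin a) : Term c a
  | var (y : ℕ) : Term c a
  | const (k : Fin c) : Term c a

/-- Atoms `C(t)`, `R(t₁, …, tₙ)` and `t ≠ t'`. -/
inductive Atom (N c a : ℕ) : Type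
  | concept (C : Concept N) (t : Term c a) : Atom N c a
  | rel (n : Arity N) (R : Rel N n) (t : Fin n.1 → Term c a) : Atom N c a
  | neq (t t' : Term c a) : Atom N c a

/-- The term `s` occurs in the given atom. -/
def Atom.Mentions {N c a : ℕ} (s : Term c a) : Atom N c a → Prop
  | .concept _ t => t = s
  | .rel _ _ t => ∃ i, t i = s
  | .neq t t' => t = s ∨ t' = s

/-- A query of arity `a`: a nonempty disjunction of nonempty conjunctions of atoms (possibly
inequalities), where every distinguished variable appears in each of the conjunctions. -/
structure Query (N c a : ℕ) : Type where
  disjuncts : List (List (Atom N c a))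
  disjuncts_ne_nil : disjuncts ≠ []
  conj_ne_nil : ∀ φ ∈ disjuncts, φ ≠ []
  head_mem : ∀ φ ∈ disjuncts, ∀ i : Fin a, ∃ α ∈ φ, α.Mentions (.head i)

/-! ### Semantics -/

/-- Interpretations, for a set of `c` constants: a nonempty domain, arbitrary interpretations of
the atomic concepts, relations `⊤ₙ` (not necessarily the full Cartesian power of the domain), atomic
relations included in them, and constants under the unique name assumption. -/
structure Interp (N c : ℕ) : Type 1 where
  Dom : Type
  nonempty : Nonempty Dom
  concept : ℕ → Set Dom
  top : (n : Arity N) → Set (Fin n.1 → Dom)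
  rel : (n : Arity N) → ℕ → Set (Fin n.1 → Dom)
  rel_subset : ∀ n P, rel n P ⊆ top n
  const : Fin c → Dom
  const_injective : Function.Injective const

mutual

/-- The extension of a concept. -/
def Concept.ext {N c : ℕ} (I : Interp N c) : Concept N → Set I.Dom
  | .top => Set.univ
  | .atom A => I.concept A
  | .neg C => (C.ext I)ᶜ
  | .inf C₁ C₂ => C₁.ext I ∩ C₂.ext I
  | .ex E C => {d | ∃ d' ∈ C.ext I, E.ext I d d'}
  | .exComp _ i R => {d | ∃ t ∈ R.ext I, t i = d}
  | .atMost k _ i R => {d | {t | t ∈ R.ext I ∧ t i = d}.encard ≤ k}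

/-- The extension of a relation. -/
def Rel.ext {N c : ℕ} (I : Interp N c) : {n : Arity N} → Rel N n → Set (Fin n.1 → I.Dom)
  | _, .top n => I.top n
  | _, .atom n P => I.rel n P
  | _, .comp n i C => {t | t ∈ I.top n ∧ t i ∈ C.ext I}
  | _, .neg n R => I.top n \ R.ext I
  | _, .inf _ R₁ R₂ => R₁.ext I ∩ R₂.ext I

/-- The extension of a regular expression, a binary relation on the domain. -/
def RegExp.ext {N c : ℕ} (I : Interp N c) : RegExp N → I.Dom → I.Dom → Prop
  | .eps => fun d d' => d = d'
  | .proj _ R i j => fun d d' => ∃ t ∈ R.ext I, t i = d ∧ t j = d'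
  | .comp E₁ E₂ => Relation.Comp (E₁.ext I) (E₂.ext I)
  | .union E₁ E₂ => fun d d' => E₁.ext I d d' ∨ E₂.ext I d d'
  | .star E => Relation.ReflTransGen (E.ext I)

end

/-- The interpretation satisfies the assertion. -/
def Assertion.Sat {N c : ℕ} (I : Interp N c) : Assertion N → Prop
  | .concept C₁ C₂ => C₁.ext I ⊆ C₂.ext I
  | .rel _ R₁ R₂ => R₁.ext I ⊆ R₂.ext I

/-- The interpretation is a model of the schema. -/
def Interp.IsModel {N c : ℕ} (I : Interp N c) (S : Schema N) : Prop :=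
  ∀ σ ∈ S, σ.Sat I

/-- Value of a term, for the values `o` of the distinguished and `v` of the existential variables. -/
def Term.eval {N c a : ℕ} (I : Interp N c) (o : Fin a → I.Dom) (v : ℕ → I.Dom) :
    Term c a → I.Dom
  | .head i => o i
  | .var y => v y
  | .const k => I.const k

/-- Truth of an atom under an assignment. -/
def Atom.Holds {N c a : ℕ} (I : Interp N c) (o : Fin a → I.Dom) (v : ℕ → I.Dom) :
    Atom N c a → Prop
  | .concept C t => t.eval I o v ∈ C.ext I
  | .rel _ R t => (fun i => (t i).eval I o v) ∈ R.ext I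
  | .neq t t' => t.eval I o v ≠ t'.eval I o v

/-- The answers of a query in an interpretation. -/
def Query.ext {N c a : ℕ} (I : Interp N c) (q : Query N c a) : Set (Fin a → I.Dom) :=
  {o | ∃ φ ∈ q.disjuncts, ∃ v : ℕ → I.Dom, ∀ α ∈ φ, α.Holds I o v}

/-- An input of the containment problem: a finite set of constants (of which only the number `c`
matters), a schema, and two queries of the same arity. -/
structure Instance (N : ℕ) : Type where
  c : ℕ
  schema : Schema N
  arity : ℕ
  q : Query N c arity
  q' : Query N c arity

/-- Containment of `q` in `q'` with respect to the schema. -/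
def Instance.Contained {N : ℕ} (J : Instance N) : Prop :=
  ∀ I : Interp N J.c, I.IsModel J.schema → J.q.ext I ⊆ J.q'.ext I

/-! ### The restricted class of inputs -/

mutual

/-- No regular expression occurs in the concept. -/
def Concept.NoReg {N : ℕ} : Concept N → Prop
  | .top => True
  | .atom _ => True
  | .neg C => C.NoReg
  | .inf C₁ C₂ => C₁.NoReg ∧ C₂.NoReg
  | .ex _ _ => False
  | .exComp _ _ R => R.NoReg
  | .atMost _ _ _ R => R.NoReg

/-- No regular expression occurs in the relation. -/
def Rel.NoReg {N : ℕ} : {n : Arity N} → Rel N n → Prop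
  | _, .top _ => True
  | _, .atom _ _ => True
  | _, .comp _ _ C => C.NoReg
  | _, .neg _ R => R.NoReg
  | _, .inf _ R₁ R₂ => R₁.NoReg ∧ R₂.NoReg

end

/-- The assertion has the form `A ⊑ C` with `A` an atomic concept and `C` a concept without regular
expressions. -/
def Assertion.Simple {N : ℕ} (σ : Assertion N) : Prop :=
  ∃ (A : ℕ) (C : Concept N), C.NoReg ∧ σ = .concept (.atom A) C

/-- No regular expression occurs in the atom. -/
def Atom.NoReg {N c a : ℕ} : Atom N c a → Prop
  | .concept C _ => C.NoReg
  | .rel _ R _ => R.NoReg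
  | .neq _ _ => True

/-- The atom is an inequality. -/
def Atom.isNeq {N c a : ℕ} : Atom N c a → Bool
  | .neq _ _ => true
  | _ => false

/-- The query is a single conjunction, without regular expressions, in which exactly `k` of the
atoms are inequalities. -/
def Query.SimpleWith {N c a : ℕ} (k : ℕ) (q : Query N c a) : Prop :=
  ∃ φ : List (Atom N c a), q.disjuncts = [φ] ∧ (∀ α ∈ φ, α.NoReg) ∧ φ.countP Atom.isNeq = k

/-- The inputs without constants, without union and without regular expressions, all of whose
assertions have the form `A ⊑ C`, and with a single inequality in `q'` and none in `q`. -/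
def Instance.Restricted {N : ℕ} (J : Instance N) : Prop :=
  J.c = 0 ∧ (∀ σ ∈ J.schema, σ.Simple) ∧ J.q.SimpleWith 0 ∧ J.q'.SimpleWith 1

/-! ### Gödel numbering of the inputs -/

mutual

/-- Gödel number of a concept. -/
def Concept.code {N : ℕ} : Concept N → ℕ
  | .top => Nat.pair 0 0
  | .atom A => Nat.pair 1 A
  | .neg C => Nat.pair 2 C.code
  | .inf C₁ C₂ => Nat.pair 3 (Nat.pair C₁.code C₂.code)
  | .ex E C => Nat.pair 4 (Nat.pair E.code C.code)
  | .exComp _ i R => Nat.pair 5 (Nat.pair i.1 R.code)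
  | .atMost k _ i R => Nat.pair 6 (Nat.pair k (Nat.pair i.1 R.code))

/-- Gödel number of a relation. -/
def Rel.code {N : ℕ} : {n : Arity N} → Rel N n → ℕ
  | _, .top n => Nat.pair 0 n.1
  | _, .atom n P => Nat.pair 1 (Nat.pair n.1 P)
  | _, .comp n i C => Nat.pair 2 (Nat.pair n.1 (Nat.pair i.1 C.code))
  | _, .neg _ R => Nat.pair 3 R.code
  | _, .inf _ R₁ R₂ => Nat.pair 4 (Nat.pair R₁.code R₂.code)

/-- Gödel number of a regular expression. -/
def RegExp.code {N : ℕ} : RegExp N → ℕ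
  | .eps => Nat.pair 0 0
  | .proj _ R i j => Nat.pair 1 (Nat.pair R.code (Nat.pair i.1 j.1))
  | .comp E₁ E₂ => Nat.pair 2 (Nat.pair E₁.code E₂.code)
  | .union E₁ E₂ => Nat.pair 3 (Nat.pair E₁.code E₂.code)
  | .star E => Nat.pair 4 E.code

end

/-- Gödel number of an assertion. -/
def Assertion.code {N : ℕ} : Assertion N → ℕ
  | .concept C₁ C₂ => Nat.pair 0 (Nat.pair C₁.code C₂.code)
  | .rel _ R₁ R₂ => Nat.pair 1 (Nat.pair R₁.code R₂.code)

/-- Gödel number of a term. -/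
def Term.code {c a : ℕ} : Term c a → ℕ
  | .head i => Nat.pair 0 i.1
  | .var y => Nat.pair 1 y
  | .const k => Nat.pair 2 k.1

/-- Gödel number of an atom. -/
def Atom.code {N c a : ℕ} : Atom N c a → ℕ
  | .concept C t => Nat.pair 0 (Nat.pair C.code t.code)
  | .rel _ R t => Nat.pair 1 (Nat.pair R.code (Encodable.encode (List.ofFn fun i => (t i).code)))
  | .neq t t' => Nat.pair 2 (Nat.pair t.code t'.code)

/-- Gödel number of a query. -/
def Query.code {N c a : ℕ} (q : Query N c a) : ℕ :=
  Encodable.encode (q.disjuncts.map fun φ => φ.map Atom.code)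

/-- Gödel number of an input of the containment problem. -/
def Instance.code {N : ℕ} (J : Instance N) : ℕ :=
  Encodable.encode (J.c, J.schema.map Assertion.code, J.arity, J.q.code, J.q'.code)

mutual

theorem Concept.code_injective {N : ℕ} : ∀ C D : Concept N, C.code = D.code → C = D
  | .top, D, h => by
    cases D <;> simp [Concept.code, Nat.pair_eq_pair] at h <;> rfl
  | .atom A, D, h => by
    cases D <;> simp [Concept.code, Nat.pair_eq_pair] at h
    rw [h]
  | .neg C, D, h => by
    cases D <;> simp [Concept.code, Nat.pair_eq_pair] at h
    rw [Concept.code_injective C _ h]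
  | .inf C₁ C₂, D, h => by
    cases D <;> simp [Concept.code, Nat.pair_eq_pair] at h
    rw [Concept.code_injective C₁ _ h.1, Concept.code_injective C₂ _ h.2]
  | .ex E C, D, h => by
    cases D <;> simp [Concept.code, Nat.pair_eq_pair] at h
    rw [RegExp.code_injective E _ h.1, Concept.code_injective C _ h.2]
  | .exComp n i R, D, h => by
    cases D <;> simp [Concept.code, Nat.pair_eq_pair] at h
    obtain ⟨hi, hR⟩ := h
    obtain ⟨rfl, hR⟩ := Rel.code_injective R _ hR
    rw [eq_of_heq hR, Fin.ext hi]
  | .atMost k n i R, D, h => by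
    cases D <;> simp [Concept.code, Nat.pair_eq_pair] at h
    obtain ⟨hk, hi, hR⟩ := h
    obtain ⟨rfl, hR⟩ := Rel.code_injective R _ hR
    rw [eq_of_heq hR, Fin.ext hi, hk]
termination_by structural C => C

theorem Rel.code_injective {N : ℕ} : ∀ {n : Arity N} (R : Rel N n) {m : Arity N} (R' : Rel N m),
    R.code = R'.code → n = m ∧ R ≍ R'
  | _, .top n, _, R', h => by
    cases R' <;> simp [Rel.code, Nat.pair_eq_pair] at h
    obtain rfl := Subtype.ext h
    exact ⟨rfl, HEq.rfl⟩
  | _, .atom n P, _, R', h => by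
    cases R' <;> simp [Rel.code, Nat.pair_eq_pair] at h
    obtain rfl := Subtype.ext h.1
    rw [h.2]
    exact ⟨rfl, HEq.rfl⟩
  | _, .comp n i C, _, R', h => by
    cases R' <;> simp [Rel.code, Nat.pair_eq_pair] at h
    obtain rfl := Subtype.ext h.1
    rw [Fin.ext h.2.1, Concept.code_injective C _ h.2.2]
    exact ⟨rfl, HEq.rfl⟩
  | _, .neg n R, _, R', h => by
    cases R' <;> simp [Rel.code, Nat.pair_eq_pair] at h
    obtain ⟨rfl, hR⟩ := Rel.code_injective R _ h
    rw [eq_of_heq hR]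
    exact ⟨rfl, HEq.rfl⟩
  | _, .inf n R₁ R₂, _, R', h => by
    cases R' <;> simp [Rel.code, Nat.pair_eq_pair] at h
    obtain ⟨rfl, hR⟩ := Rel.code_injective R₁ _ h.1
    obtain ⟨-, hR'⟩ := Rel.code_injective R₂ _ h.2
    rw [eq_of_heq hR, eq_of_heq hR']
    exact ⟨rfl, HEq.rfl⟩
termination_by structural _ R => R

theorem RegExp.code_injective {N : ℕ} : ∀ E F : RegExp N, E.code = F.code → E = F
  | .eps, F, h => by
    cases F <;> simp [RegExp.code, Nat.pair_eq_pair] at h <;> rfl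
  | .proj n R i j, F, h => by
    cases F <;> simp [RegExp.code, Nat.pair_eq_pair] at h
    obtain ⟨hR, hi, hj⟩ := h
    obtain ⟨rfl, hR⟩ := Rel.code_injective R _ hR
    rw [eq_of_heq hR, Fin.ext hi, Fin.ext hj]
  | .comp E₁ E₂, F, h => by
    cases F <;> simp [RegExp.code, Nat.pair_eq_pair] at h
    rw [RegExp.code_injective E₁ _ h.1, RegExp.code_injective E₂ _ h.2]
  | .union E₁ E₂, F, h => by
    cases F <;> simp [RegExp.code, Nat.pair_eq_pair] at h
    rw [RegExp.code_injective E₁ _ h.1, RegExp.code_injective E₂ _ h.2]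
  | .star E, F, h => by
    cases F <;> simp [RegExp.code, Nat.pair_eq_pair] at h
    rw [RegExp.code_injective E _ h]
termination_by structural E => E

end

theorem Assertion.code_injective {N : ℕ} : Function.Injective (Assertion.code (N := N)) := by
  intro σ τ h
  cases σ <;> cases τ <;> simp only [Assertion.code, Nat.pair_eq_pair] at h <;> try omega
  · rw [Concept.code_injective _ _ h.2.1, Concept.code_injective _ _ h.2.2]
  · obtain ⟨rfl, hR⟩ := Rel.code_injective _ _ h.2.1
    obtain ⟨-, hR'⟩ := Rel.code_injective _ _ h.2.2
    rw [eq_of_heq hR, eq_of_heq hR']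

theorem Term.code_injective {c a : ℕ} : Function.Injective (Term.code (c := c) (a := a)) := by
  intro s t h
  cases s <;> cases t <;> simp only [Term.code, Nat.pair_eq_pair] at h <;> try omega
  · rw [Fin.ext h.2]
  · rw [h.2]
  · rw [Fin.ext h.2]

theorem Atom.code_injective {N c a : ℕ} :
    Function.Injective (Atom.code (N := N) (c := c) (a := a)) := by
  intro α β h
  cases α <;> cases β <;> simp only [Atom.code, Nat.pair_eq_pair] at h <;> try omega
  · rw [Concept.code_injective _ _ h.2.1, Term.code_injective h.2.2]
  · obtain ⟨-, hR, ht⟩ := h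
    obtain ⟨rfl, hR⟩ := Rel.code_injective _ _ hR
    have ht' := List.ofFn_injective (Encodable.encode_injective ht)
    rw [eq_of_heq hR, funext fun i => Term.code_injective (congrFun ht' i)]
  · rw [Term.code_injective h.2.1, Term.code_injective h.2.2]

theorem Query.code_injective {N c a : ℕ} :
    Function.Injective (Query.code (N := N) (c := c) (a := a)) := by
  intro q r h
  have h' := (Atom.code_injective.list_map.list_map) (Encodable.encode_injective h)
  cases q
  cases r
  cases h'
  rfl

/-- Different inputs have different Gödel numbers. -/
theorem Instance.code_injective {N : ℕ} : Function.Injective (Instance.code (N := N)) := by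
  intro J K h
  have h' := Encodable.encode_injective h
  obtain ⟨c, S, a, q, q'⟩ := J
  obtain ⟨d, T, b, r, r'⟩ := K
  simp only [Prod.mk.injEq] at h'
  obtain ⟨rfl, hS, rfl, hq, hq'⟩ := h'
  rw [Assertion.code_injective.list_map hS, Query.code_injective hq, Query.code_injective hq']

/-- The containment problem is decidable on the class `K` of inputs: some computable predicate gives
the correct answer on (the Gödel numbers of) all inputs in `K`. -/
def ContainmentDecidableOn {N : ℕ} (K : Set (Instance N)) : Prop :=
  ∃ p : ℕ → Prop, ComputablePred p ∧ ∀ J ∈ K, (p J.code ↔ J.Contained)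

end DLR

-- Machine runs as tilings of the quarter plane

namespace DLR

open Turing

-- The halting problem reduces to tiling the quarter plane with a prescribed bottom row, and tiling
-- reduces to non-containment.
--
-- A run is laid out with one configuration per row. Tapes are centred at the head, so a head move
-- shifts the whole tape, and folding at the head puts a two-sided tape on a half-line. Each tile
-- repeats the state and the scanned symbol and sees a window of three symbols on each half, so one
-- step can be checked column by column. An infinite stack of rows exists exactly when the machine
-- never halts (`Tile.exists_isTiling_iff`).
--
-- For given tiles, the schema says that a grid point has a right and an upper successor in the grid
-- and carries a single tile matching those of all its successors. Concepts cannot force the two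
-- steps to commute, but the inequality can: `q'` asks for right-then-up and up-then-right paths
-- from a common point with different ends. A model where `q` holds and `q'` fails thus has chosen
-- successor maps that commute, which yields a tiling; conversely a tiling turns the grid `ℕ × ℕ`
-- into such a model (`tilingInstance_contained_iff`). Neither role need be functional.
--
-- The machine is fixed and only the input varies, as a block of `m` equal symbols
-- (`exists_machine_halting_undecidable`). Hence the schema and `q'` are fixed and `m` enters only
-- through an iterated concept in `q`, which makes the reduction computable.

/-- `T` is a tiling of the quarter plane respecting the horizontal and vertical compatibility
relations, whose bottom row has its tiles in the sets listed in `l`, and in `B` from there on. -/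
structure IsTiling {W : Type} (H V : W → W → Prop) (l : List (Set W)) (B : Set W)
    (T : ℕ → ℕ → W) : Prop where
  horizontal : ∀ i j, H (T i j) (T (i + 1) j)
  vertical : ∀ i j, V (T i j) (T i (j + 1))
  bottom : ∀ i, T i 0 ∈ l.getD i B

/-- Tiles describing the computation of a machine.  The tape is folded at the position of the head,
so that the `i`-th tile of a row sees the tape at the positions `i` and `-i`. -/
structure Tile (Γ Λ : Type) : Type where
  state : Λ
  origin : Bool
  head : Γ
  /-- the symbols at the positions `i - 1`, `i`, `i + 1` -/
  fwd : Γ × Γ × Γ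
  /-- the symbols at the positions `-i - 1`, `-i`, `-i + 1` -/
  bwd : Γ × Γ × Γ

namespace Tile

variable {Γ Λ : Type}

/-- The label type of the machine need not be finite; only a supporting set of states is. Tiles are
therefore restricted to states in that set, which leaves finitely many. -/
theorem finite_state_mem [Finite Γ] {S : Set Λ} (hS : S.Finite) :
    Finite {w : Tile Γ Λ // w.state ∈ S} := by
  have := hS.to_subtype
  refine Finite.of_injective
    (β := S × Bool × Γ × (Γ × Γ × Γ) × (Γ × Γ × Γ))
    (fun w => (⟨w.1.state, w.2⟩, w.1.origin, w.1.head, w.1.fwd, w.1.bwd)) ?_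
  rintro ⟨⟨⟩, _⟩ ⟨⟨⟩, _⟩ h
  simp_all

/-- Compatibility of a tile with its right neighbour. -/
structure HCompat (w w' : Tile Γ Λ) : Prop where
  state : w'.state = w.state
  head : w'.head = w.head
  origin : w'.origin = false
  fwd_left : w'.fwd.1 = w.fwd.2.1
  fwd_mid : w'.fwd.2.1 = w.fwd.2.2
  bwd_mid : w'.bwd.2.1 = w.bwd.1
  bwd_right : w'.bwd.2.2 = w.bwd.2.1
  head_eq : w.origin = true → w.head = w.fwd.2.1
  bwd_eq : w.origin = true → w.bwd = w.fwd

/-- The effect of a machine instruction on the two symbols seen by a tile. -/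
def Update (w w' : Tile Γ Λ) : TM0.Stmt Γ → Prop
  | .move .left => w'.fwd.2.1 = w.fwd.1 ∧ w'.bwd.2.1 = w.bwd.1
  | .move .right => w'.fwd.2.1 = w.fwd.2.2 ∧ w'.bwd.2.1 = w.bwd.2.2
  | .write a => w'.fwd.2.1 = (if w.origin then a else w.fwd.2.1) ∧
      w'.bwd.2.1 = (if w.origin then a else w.bwd.2.1)

variable [Inhabited Γ]

/-- Compatibility of a tile with its upper neighbour. -/
def VCompat [Inhabited Λ] (M : TM0.Machine Γ Λ) (w w' : Tile Γ Λ) : Prop :=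
  w'.origin = w.origin ∧ ∃ s, M w.state w.head = some (w'.state, s) ∧ Update w w' s

/-- The tiles that may start the bottom row of a computation on a tape with first symbol `s`. -/
def first [Inhabited Λ] (s : Γ) : Set (Tile Γ Λ) :=
  {w | w.state = default ∧ w.origin = true ∧ w.fwd.2.1 = s}

/-- The tiles of the bottom row that see the symbol `s` on the right half of the tape. -/
def cell (s : Γ) : Set (Tile Γ Λ) :=
  {w | w.fwd.2.1 = s ∧ w.bwd.2.1 = default}

/-- The `i`-th tile of the row describing a configuration. -/
def ofCfg (c : TM0.Cfg Γ Λ) (i : ℕ) : Tile Γ Λ where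
  state := c.q
  origin := decide (i = 0)
  head := c.Tape.head
  fwd := (c.Tape.nth (i - 1), c.Tape.nth i, c.Tape.nth (i + 1))
  bwd := (c.Tape.nth (-i - 1), c.Tape.nth (-i), c.Tape.nth (-i + 1))

theorem ofCfg_hCompat (c : TM0.Cfg Γ Λ) (i : ℕ) : HCompat (ofCfg c i) (ofCfg c (i + 1)) where
  state := rfl
  head := rfl
  origin := by simp [ofCfg]
  fwd_left := by simp [ofCfg]
  fwd_mid := by simp [ofCfg]
  bwd_mid := by simp only [ofCfg]; congr 1; push_cast; ring
  bwd_right := by simp [ofCfg]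
  head_eq := by simp +contextual [ofCfg]
  bwd_eq := by simp +contextual [ofCfg]

theorem ofCfg_vCompat [Inhabited Λ] (M : TM0.Machine Γ Λ) {c c' : TM0.Cfg Γ Λ}
    (h : TM0.step M c = some c') (i : ℕ) :
    VCompat M (ofCfg c i) (ofCfg c' i) := by
  obtain ⟨q, t⟩ := c
  obtain ⟨⟨q', s⟩, hs, rfl⟩ := Option.map_eq_some_iff.1 h
  refine ⟨rfl, s, hs, ?_⟩
  match s with
  | .move .left => simp [Update, ofCfg]
  | .move .right => simp [Update, ofCfg]
  | .write a => simp [Update, ofCfg]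

/-- The symbols in the middle of the `i`-th tile of a row, and its other data, are those of the
given configuration. -/
structure Describes (r : ℕ → Tile Γ Λ) (c : TM0.Cfg Γ Λ) : Prop where
  state : ∀ i, (r i).state = c.q
  head : ∀ i, (r i).head = c.Tape.head
  origin : ∀ i, (r i).origin = decide (i = 0)
  fwd : ∀ i : ℕ, (r i).fwd.2.1 = c.Tape.nth i
  bwd : ∀ i : ℕ, (r i).bwd.2.1 = c.Tape.nth (-i)

/-- Horizontal compatibility copies the state and the scanned symbol to the right and clears the
origin flag, so these data need checking only in column 0. -/
theorem describes_of_zero {r : ℕ → Tile Γ Λ} {c : TM0.Cfg Γ Λ}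
    (hr : ∀ i, HCompat (r i) (r (i + 1))) (hq : (r 0).state = c.q) (h₀ : (r 0).origin = true)
    (hf : ∀ i : ℕ, (r i).fwd.2.1 = c.Tape.nth i) (hb : ∀ i : ℕ, (r i).bwd.2.1 = c.Tape.nth (-i)) :
    Describes r c where
  state i := by
    induction i with
    | zero => exact hq
    | succ i ih => rw [(hr i).state, ih]
  head i := by
    induction i with
    | zero => rw [(hr 0).head_eq h₀, hf]; rfl
    | succ i ih => rw [(hr i).head, ih]
  origin i := by
    cases i with
    | zero => simpa using h₀
    | succ i => simp [(hr i).origin]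
  fwd := hf
  bwd := hb

/-- The outer symbols of each window are middle symbols of neighbouring tiles. Column 0 has no left
neighbour; there the fold condition supplies the missing symbols from the other half. -/
theorem Describes.eq_ofCfg {r : ℕ → Tile Γ Λ} {c : TM0.Cfg Γ Λ} (h : Describes r c)
    (hr : ∀ i, HCompat (r i) (r (i + 1))) (i : ℕ) : r i = ofCfg c i := by
  have hfr : (r i).fwd.2.2 = c.Tape.nth (i + 1) := by
    rw [← (hr i).fwd_mid, h.fwd]; simp
  have hbl : ∀ i : ℕ, (r i).bwd.1 = c.Tape.nth (-i - 1) := fun i => by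
    rw [← (hr i).bwd_mid, h.bwd]; congr 1; push_cast; ring
  have hfl : (r i).fwd.1 = c.Tape.nth (i - 1) := by
    cases i with
    | zero => rw [← (hr 0).bwd_eq (by simp [h.origin]), hbl]; simp
    | succ i => rw [(hr i).fwd_left, h.fwd]; simp
  have hbr : (r i).bwd.2.2 = c.Tape.nth (-i + 1) := by
    cases i with
    | zero => rw [(hr 0).bwd_eq (by simp [h.origin]), hfr]; simp
    | succ i => rw [(hr i).bwd_right, h.bwd]; simp
  have e₁ := h.state i
  have e₂ := h.origin i
  have e₃ := h.head i
  have e₄ := h.fwd i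
  have e₅ := h.bwd i
  have e₆ := hbl i
  revert e₁ e₂ e₃ e₄ e₅ e₆ hfr hfl hbr
  rcases r i with ⟨_, _, _, ⟨_, _, _⟩, ⟨_, _, _⟩⟩
  simp +contextual [ofCfg]

variable [Inhabited Λ] {M : TM0.Machine Γ Λ}

/-- A row with a row above it cannot describe a halting configuration, and the upper row is forced
to be the next configuration. -/
theorem Describes.exists_step {r r' : ℕ → Tile Γ Λ} {c : TM0.Cfg Γ Λ} (h : Describes r c)
    (hr : ∀ i, HCompat (r i) (r (i + 1))) (hr' : ∀ i, HCompat (r' i) (r' (i + 1)))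
    (hv : ∀ i, VCompat M (r i) (r' i)) : ∃ c', TM0.step M c = some c' ∧ Describes r' c' := by
  obtain rfl : r = ofCfg c := funext (h.eq_ofCfg hr)
  obtain ⟨ho, s, hs, -⟩ := hv 0
  obtain ⟨q, t⟩ := c
  -- All columns carry the same state and scanned symbol, hence execute the same instruction.
  have hu : ∀ i, Update (ofCfg ⟨q, t⟩ i) (r' i) s := fun i => by
    obtain ⟨-, s', hs', hu⟩ := hv i
    have := hs.symm.trans hs'
    simp only [Option.some.injEq, Prod.mk.injEq] at this
    rwa [this.2]
  refine ⟨_, by rw [TM0.step]; exact congrArg _ hs, describes_of_zero hr' rfl ?_ ?_ ?_⟩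
  · rw [ho]; rfl
  · intro i
    match s with
    | .move .left => simpa [Update, ofCfg] using (hu i).1
    | .move .right => simpa [Update, ofCfg] using (hu i).1
    | .write a => simpa [Update, ofCfg] using (hu i).1
  · intro i
    match s with
    | .move .left => simpa [Update, ofCfg] using (hu i).2
    | .move .right => simpa [Update, ofCfg] using (hu i).2
    | .write a => simpa [Update, ofCfg] using (hu i).2

/-- A machine runs forever on the given nonempty input if and only if there is a tiling whose bottom
row describes the initial configuration. -/
theorem exists_isTiling_iff {S : Set Λ} (hS : TM0.Supports M S) (s : Γ) (l : List Γ) :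
    (∃ T : ℕ → ℕ → {w : Tile Γ Λ // w.state ∈ S},
      IsTiling (fun w w' => HCompat w.1 w'.1) (fun w w' => VCompat M w.1 w'.1)
        (Subtype.val ⁻¹' first s :: l.map fun a => Subtype.val ⁻¹' cell a)
        (Subtype.val ⁻¹' cell default) T) ↔ ¬ (TM0.eval M (s :: l)).Dom := by
  have hnth (i : ℕ) : (Tape.mk₁ (s :: l)).nth i = (s :: l).getD i default := by
    rw [Tape.mk₁, Tape.mk₂, Tape.mk'_nth_nat, ListBlank.nth_mk, List.getI_eq_getElem?_getD,
      List.getD_eq_getElem?_getD]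
  have hnth' (i : ℕ) : (Tape.mk₁ (s :: l)).nth (-(i + 1 : ℕ)) = default := by
    change (ListBlank.mk ([] : List Γ)).nth i = default
    rw [ListBlank.nth_mk, List.getI_nil]
  let cell' (a : Γ) : Set {w : Tile Γ Λ // w.state ∈ S} := Subtype.val ⁻¹' cell a
  have hcell (i : ℕ) : (l.map cell').getD i (cell' default) = cell' (l.getD i default) :=
    List.getD_map ..
  constructor
  · rintro ⟨T, hH, hV, hB⟩ hd
    obtain ⟨b, hb⟩ := Part.dom_iff_mem.1 (show (StateTransition.eval _ _).Dom from hd)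
    obtain ⟨hr, hn⟩ := StateTransition.mem_eval.1 hb
    -- Every configuration reached is described by some row. For the halting one, the row above it
    -- gives the contradiction.
    have key : ∃ j, Describes (fun i => (T i j).1) b := by
      clear hb hn
      induction hr with
      | refl =>
        have h₀ := hB 0
        have hs (i : ℕ) := hB (i + 1)
        simp only [List.getD_cons_succ] at hs
        change ∀ i, _ ∈ (l.map cell').getD i (cell' default) at hs
        simp only [hcell] at hs
        refine ⟨0, describes_of_zero (hH · 0) h₀.1 h₀.2.1 (fun i => ?_) fun i => ?_⟩
        · refine Eq.trans ?_ (hnth i).symm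
          cases i with
          | zero => exact h₀.2.2
          | succ i => exact (hs i).1
        · cases i with
          -- `first` leaves the backward window free; the fold condition fixes it.
          | zero =>
            have := (hH 0 0).bwd_eq h₀.2.1
            rw [this, h₀.2.2]
            rfl
          | succ i => exact (hs i).2.trans (hnth' i).symm
      | tail _ h ih =>
        obtain ⟨j, hj⟩ := ih
        obtain ⟨c', hc, hd⟩ := hj.exists_step (hH · j) (hH · (j + 1)) (hV · j)
        cases hc.symm.trans h
        exact ⟨j + 1, hd⟩
    obtain ⟨j, hj⟩ := key
    obtain ⟨c', hc, -⟩ := hj.exists_step (hH · j) (hH · (j + 1)) (hV · j)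
    simp [hn] at hc
  · intro hd
    -- On reachable configurations with state in `S` the step is total, so it can be iterated
    -- forever.
    have hstep : ∀ c : {c // StateTransition.Reaches (TM0.step M) (TM0.init (s :: l)) c ∧ c.q ∈ S},
        ∃ c' : {c // StateTransition.Reaches (TM0.step M) (TM0.init (s :: l)) c ∧ c.q ∈ S},
          TM0.step M c.1 = some c'.1 := by
      rintro ⟨c, hc, hq⟩
      cases e : TM0.step M c with
      | none => exact absurd (Part.dom_iff_mem.2 ⟨c, StateTransition.mem_eval.2 ⟨hc, e⟩⟩) hd
      | some c' => exact ⟨⟨c', hc.tail e, TM0.step_supports M hS e hq⟩, rfl⟩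
    choose next hnext using hstep
    let c (j : ℕ) := next^[j] ⟨TM0.init (s :: l), .refl, hS.1⟩
    refine ⟨fun i j => ⟨ofCfg (c j).1 i, (c j).2.2⟩, fun i j => ofCfg_hCompat _ _, fun i j => ?_,
      fun i => ?_⟩
    · refine ofCfg_vCompat M ?_ i
      rw [hnext, ← Function.iterate_succ_apply' next]
    · cases i with
      | zero => exact ⟨rfl, rfl, rfl⟩
      | succ i =>
        rw [List.getD_cons_succ]
        change _ ∈ (l.map cell').getD i (cell' default)
        rw [hcell]
        exact ⟨hnth (i + 1), hnth' i⟩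

end Tile

end DLR

-- Role restrictions and tiling constraints as concepts

namespace DLR

variable {N : ℕ} (hN : 2 ≤ N) {c : ℕ}

/-- The arity of binary relations. -/
abbrev binary : Arity N := ⟨2, le_rfl, hN⟩

/-- The pair `(d, e)` belongs to the atomic binary relation `P`. -/
def Interp.Role (I : Interp N c) (P : ℕ) (d e : I.Dom) : Prop :=
  (![d, e] : Fin 2 → I.Dom) ∈ I.rel (binary hN) P

namespace Concept

/-- The concept `∃P.C`, for an atomic binary relation `P`. -/
def someRole (P : ℕ) (C : Concept N) : Concept N :=
  .exComp (binary hN) (0 : Fin 2) (.inf _ (.atom _ P) (.comp _ (1 : Fin 2) C))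

/-- The concept `∀P.C`, for an atomic binary relation `P`. -/
def allRole (P : ℕ) (C : Concept N) : Concept N :=
  .neg (someRole hN P (.neg C))

/-- Intersection of finitely many concepts. -/
def interList (L : List (Concept N)) : Concept N :=
  L.foldr .inf .top

/-- Union of finitely many concepts. -/
def unionList (L : List (Concept N)) : Concept N :=
  .neg (interList (L.map .neg))

/-- The component restriction also demands membership in `⊤₂`, which may be a proper subset of all
pairs; atomic relations lie inside it, so nothing is lost. -/
theorem mem_ext_someRole {I : Interp N c} {P : ℕ} {C : Concept N} {d : I.Dom} :
    d ∈ (someRole hN P C).ext I ↔ ∃ e ∈ C.ext I, I.Role hN P d e := by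
  have eta (t : Fin 2 → I.Dom) : t = ![t 0, t 1] := by ext i; fin_cases i <;> rfl
  constructor
  · rintro ⟨t, ⟨ht, -, hC⟩, rfl⟩
    refine ⟨_, hC, ?_⟩
    rw [Rel.ext, eta t] at ht
    exact ht
  · rintro ⟨e, he, hr⟩
    exact ⟨![d, e], ⟨hr, I.rel_subset _ _ hr, he⟩, rfl⟩

theorem mem_ext_allRole {I : Interp N c} {P : ℕ} {C : Concept N} {d : I.Dom} :
    d ∈ (allRole hN P C).ext I ↔ ∀ e, I.Role hN P d e → e ∈ C.ext I := by
  rw [allRole, ext, Set.mem_compl_iff, mem_ext_someRole]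
  simp only [ext, Set.mem_compl_iff]
  grind

theorem mem_ext_inf {I : Interp N c} {C D : Concept N} {d : I.Dom} :
    d ∈ (inf C D).ext I ↔ d ∈ C.ext I ∧ d ∈ D.ext I := by
  rw [ext, Set.mem_inter_iff]

theorem mem_ext_neg {I : Interp N c} {C : Concept N} {d : I.Dom} :
    d ∈ (neg C).ext I ↔ d ∉ C.ext I := by
  rw [ext, Set.mem_compl_iff]

theorem mem_ext_interList {I : Interp N c} {L : List (Concept N)} {d : I.Dom} :
    d ∈ (interList L).ext I ↔ ∀ C ∈ L, d ∈ C.ext I := by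
  induction L with
  | nil => simp [interList, ext]
  | cons C L ih => rw [interList] at ih; simp [interList, mem_ext_inf, ih]

theorem mem_ext_unionList {I : Interp N c} {L : List (Concept N)} {d : I.Dom} :
    d ∈ (unionList L).ext I ↔ ∃ C ∈ L, d ∈ C.ext I := by
  simp [unionList, mem_ext_neg, mem_ext_interList]

theorem noReg_someRole {P : ℕ} {C : Concept N} (h : C.NoReg) : (someRole hN P C).NoReg := by
  simpa [someRole, NoReg, Rel.NoReg] using h

theorem noReg_allRole {P : ℕ} {C : Concept N} (h : C.NoReg) : (allRole hN P C).NoReg := by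
  simpa [allRole, NoReg] using noReg_someRole hN (by simpa [NoReg] using h)

theorem noReg_interList {L : List (Concept N)} (h : ∀ C ∈ L, C.NoReg) : (interList L).NoReg := by
  induction L with
  | nil => simp [interList, NoReg]
  | cons C L ih =>
    simp only [List.mem_cons, forall_eq_or_imp] at h
    exact ⟨h.1, ih h.2⟩

theorem noReg_unionList {L : List (Concept N)} (h : ∀ C ∈ L, C.NoReg) : (unionList L).NoReg := by
  simpa [unionList, NoReg] using noReg_interList (by simpa [NoReg] using h)

end Concept

/-! ### Tilings as models -/

section Tiling

variable {W : Type} [Fintype W]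

/-- The atomic concept denoting the elements that carry the tile `w`. -/
noncomputable def tileConcept (w : W) : Concept N :=
  -- The names 0 and 1 are reserved for `gridPoint` and `rowTail`.
  .atom (Fintype.equivFin W w + 2)

open Classical in
/-- The elements that carry a tile from the given set. -/
noncomputable def tileIn (s : Set W) : Concept N :=
  .unionList ((Finset.univ.filter (· ∈ s)).toList.map tileConcept)

/-- The elements that carry the tile `w` and no other one. -/
noncomputable def onlyTile (w : W) : Concept N :=
  .inf (tileConcept w) (.neg (tileIn {w}ᶜ))

/-- The atomic concept of the points of the grid. -/
def gridPoint : Concept N := .atom 0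

/-- The atomic concept of the points of the bottom row that are not restricted individually. -/
def rowTail : Concept N := .atom 1

theorem mem_ext_tileIn {I : Interp N c} {s : Set W} {d : I.Dom} :
    d ∈ (tileIn s).ext I ↔ ∃ w ∈ s, d ∈ (tileConcept w).ext I := by
  simp [tileIn, Concept.mem_ext_unionList]

theorem mem_ext_onlyTile {I : Interp N c} {w : W} {d : I.Dom} :
    d ∈ (onlyTile w).ext I ↔ ∀ w', d ∈ (tileConcept w').ext I ↔ w' = w := by
  simp only [onlyTile, Concept.mem_ext_inf, Concept.mem_ext_neg, mem_ext_tileIn, Set.mem_compl_iff,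
    Set.mem_singleton_iff]
  grind

theorem noReg_tileIn (s : Set W) : (tileIn (N := N) s).NoReg := by
  refine Concept.noReg_unionList fun C hC => ?_
  obtain ⟨w, -, rfl⟩ := List.mem_map.1 hC
  trivial

variable (H V : W → W → Prop) (B : Set W)

/-- A point of the grid has a horizontal and a vertical successor in the grid, and carries a
unique tile, which is compatible with those of the successors. -/
noncomputable def gridConcept : Concept N :=
  .inf (.inf (.someRole hN 0 gridPoint) (.someRole hN 1 gridPoint)) <|
    .unionList <| Finset.univ.toList.map fun w : W => .inf (onlyTile w) <|
      .inf (.allRole hN 0 (tileIn {w' | H w w'})) (.allRole hN 1 (tileIn {w' | V w w'}))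

/-- The schema whose models contain tilings. -/
noncomputable def tilingSchema : Schema N :=
  [.concept gridPoint (gridConcept hN H V),
   .concept rowTail (.inf (tileIn B) (.allRole hN 0 rowTail))]

/-- The concept describing the start of the bottom row. -/
noncomputable def rowConcept (l : List (Set W)) : Concept N :=
  l.foldr (fun s C => .inf (tileIn s) (.allRole hN 0 C)) rowTail

/-- The query asking for the origin of the grid. -/
noncomputable def originQuery (l : List (Set W)) : Query N 0 0 where
  disjuncts := [[.concept gridPoint (.var 0), .concept (rowConcept hN l) (.var 0)]]
  disjuncts_ne_nil := by simp
  conj_ne_nil := by simp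
  head_mem := by simp

/-- The atom `P(x, y)`. -/
def roleAtom (P x y : ℕ) : Atom N 0 0 :=
  .rel (binary hN) (.atom _ P) (![.var x, .var y] : Fin 2 → Term 0 0)

/-- The query asking for a horizontal and a vertical step that do not commute. -/
def squareQuery : Query N 0 0 where
  disjuncts := [[roleAtom hN 0 0 1, roleAtom hN 1 1 2, roleAtom hN 1 0 3, roleAtom hN 0 3 4,
    .neq (.var 2) (.var 4)]]
  disjuncts_ne_nil := by simp
  conj_ne_nil := by simp
  head_mem := by simp

/-- The containment problem that fails if and only if there is a tiling. -/
noncomputable def tilingInstance (l : List (Set W)) : Instance N where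
  c := 0
  schema := tilingSchema hN H V B
  arity := 0
  q := originQuery hN l
  q' := squareQuery hN

theorem noReg_rowConcept (l : List (Set W)) : (rowConcept hN l).NoReg := by
  induction l with
  | nil => trivial
  | cons s l ih => exact ⟨noReg_tileIn s, Concept.noReg_allRole hN ih⟩

theorem noReg_gridConcept : (gridConcept hN H V).NoReg := by
  refine ⟨⟨Concept.noReg_someRole hN trivial, Concept.noReg_someRole hN trivial⟩,
    Concept.noReg_unionList fun C hC => ?_⟩
  obtain ⟨w, -, rfl⟩ := List.mem_map.1 hC
  exact ⟨⟨trivial, noReg_tileIn (N := N) _⟩, Concept.noReg_allRole hN (noReg_tileIn _),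
    Concept.noReg_allRole hN (noReg_tileIn _)⟩

theorem tilingInstance_restricted (l : List (Set W)) :
    (tilingInstance hN H V B l).Restricted := by
  refine ⟨rfl, fun σ hσ => ?_, ⟨_, rfl, ?_, rfl⟩, ⟨_, rfl, ?_, rfl⟩⟩
  · simp only [tilingInstance, tilingSchema, List.mem_cons, List.not_mem_nil, or_false] at hσ
    obtain rfl | rfl := hσ
    · exact ⟨0, _, noReg_gridConcept hN H V, rfl⟩
    · exact ⟨1, .inf (tileIn B) (.allRole hN 0 rowTail),
        ⟨noReg_tileIn _, Concept.noReg_allRole hN trivial⟩, rfl⟩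
  · rintro α (_ | ⟨_, _ | ⟨_, ⟨⟩⟩⟩)
    exacts [trivial, noReg_rowConcept hN l]
  · rintro α (_ | ⟨_, _ | ⟨_, _ | ⟨_, _ | ⟨_, _ | ⟨_, ⟨⟩⟩⟩⟩⟩⟩) <;> trivial

theorem mem_originQuery_ext {I : Interp N 0} {l : List (Set W)} {o : Fin 0 → I.Dom} :
    o ∈ (originQuery hN l).ext I ↔ ∃ d ∈ I.concept 0, d ∈ (rowConcept hN l).ext I := by
  simp only [Query.ext, originQuery, exists_eq_left, Set.mem_ofPred_eq,
    List.mem_cons, List.not_mem_nil, or_false, forall_eq_or_imp, forall_eq, Atom.Holds, Term.eval]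
  exact ⟨fun ⟨v, hv⟩ => ⟨v 0, hv⟩, fun ⟨d, hd⟩ => ⟨fun _ => d, hd⟩⟩

theorem mem_squareQuery_ext {I : Interp N 0} {o : Fin 0 → I.Dom} :
    o ∈ (squareQuery hN).ext I ↔ ∃ x y z y' z', I.Role hN 0 x y ∧ I.Role hN 1 y z ∧
      I.Role hN 1 x y' ∧ I.Role hN 0 y' z' ∧ z ≠ z' := by
  have hrole (P x y : ℕ) (v : ℕ → I.Dom) :
      (roleAtom hN P x y).Holds I o v ↔ I.Role hN P (v x) (v y) := by
    have : (fun i => Term.eval I o v ((![.var x, .var y] : Fin 2 → Term 0 0) i)) =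
        ![v x, v y] := by ext i; fin_cases i <;> rfl
    change (fun i => Term.eval I o v ((![.var x, .var y] : Fin 2 → Term 0 0) i)) ∈ _ ↔ _
    rw [this]
    rfl
  simp only [Query.ext, squareQuery, exists_eq_left, Set.mem_ofPred_eq,
    List.mem_cons, List.not_mem_nil, or_false, forall_eq_or_imp, forall_eq, hrole]
  simp only [Atom.Holds, Term.eval]
  exact ⟨fun ⟨v, hv⟩ => ⟨_, _, _, _, _, hv⟩, fun ⟨x, y, z, y', z', h⟩ =>
    ⟨fun n => [x, y, z, y', z'].getD n x, h⟩⟩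

variable {H V B}

/-- The two steps of the grid: to the right for `P = 0`, upwards otherwise. -/
def gridStep (P : ℕ) (d : ℕ × ℕ) : ℕ × ℕ :=
  if P = 0 then (d.1 + 1, d.2) else (d.1, d.2 + 1)

/-- The interpretation given by a tiling. -/
noncomputable abbrev gridInterp (N : ℕ) (l : List (Set W)) (T : ℕ → ℕ → W) : Interp N 0 where
  Dom := ℕ × ℕ
  nonempty := ⟨(0, 0)⟩
  concept
    | 0 => Set.univ
    | 1 => {d | d.2 = 0 ∧ l.length ≤ d.1}
    | A + 2 => {d | Fintype.equivFin W (T d.1 d.2) = A}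
  top _ := Set.univ
  -- Only arity 2 matters; looking at the first two components gives a uniform definition for all
  -- arities.
  rel n P := {t | t ⟨1, n.2.1⟩ = gridStep P (t ⟨0, zero_lt_two.trans_le n.2.1⟩)}
  rel_subset _ _ := Set.subset_univ _
  const := Fin.elim0
  const_injective i := i.elim0

section

variable {l : List (Set W)} {T : ℕ → ℕ → W}

theorem gridInterp_role {P : ℕ} {d e : (gridInterp N l T).Dom} :
    (gridInterp N l T).Role hN P d e ↔ e = gridStep P d := Iff.rfl

theorem gridInterp_tileConcept {w : W} {d : (gridInterp N l T).Dom} :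
    d ∈ (tileConcept w).ext (gridInterp N l T) ↔ T d.1 d.2 = w := by
  change ((Fintype.equivFin W (T d.1 d.2) : ℕ) = Fintype.equivFin W w) ↔ _
  rw [Fin.val_inj, EmbeddingLike.apply_eq_iff_eq]

theorem gridInterp_tileIn {s : Set W} {d : (gridInterp N l T).Dom} :
    d ∈ (tileIn s).ext (gridInterp N l T) ↔ T d.1 d.2 ∈ s := by
  rw [mem_ext_tileIn]
  exact ⟨fun ⟨w, hw, h⟩ => gridInterp_tileConcept.1 h ▸ hw,
    fun h => ⟨_, h, gridInterp_tileConcept.2 rfl⟩⟩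

theorem gridInterp_isModel (hT : IsTiling H V l B T) :
    (gridInterp N l T).IsModel (tilingSchema hN H V B) := by
  simp only [Interp.IsModel, tilingSchema, List.mem_cons, List.not_mem_nil, or_false,
    forall_eq_or_imp, forall_eq]
  constructor
  · rintro d -
    refine Concept.mem_ext_inf.2 ⟨Concept.mem_ext_inf.2
      ⟨(Concept.mem_ext_someRole hN).2 ⟨_, trivial, (gridInterp_role hN).2 rfl⟩,
        (Concept.mem_ext_someRole hN).2 ⟨_, trivial, (gridInterp_role hN).2 rfl⟩⟩, ?_⟩
    refine Concept.mem_ext_unionList.2 ⟨_, List.mem_map.2 ⟨T d.1 d.2, by simp, rfl⟩, ?_⟩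
    refine Concept.mem_ext_inf.2 ⟨mem_ext_onlyTile.2 fun w => ?_, Concept.mem_ext_inf.2 ⟨?_, ?_⟩⟩
    · exact gridInterp_tileConcept.trans eq_comm
    · refine (Concept.mem_ext_allRole hN).2 fun e he => gridInterp_tileIn.2 ?_
      rw [(gridInterp_role hN).1 he]
      exact hT.horizontal _ _
    · refine (Concept.mem_ext_allRole hN).2 fun e he => gridInterp_tileIn.2 ?_
      rw [(gridInterp_role hN).1 he]
      exact hT.vertical _ _
  · rintro d ⟨h₀, hd⟩
    refine Concept.mem_ext_inf.2 ⟨gridInterp_tileIn.2 ?_, (Concept.mem_ext_allRole hN).2 ?_⟩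
    · have := hT.bottom d.1
      rwa [List.getD_eq_default _ _ hd, ← h₀] at this
    · intro e he
      rw [(gridInterp_role hN).1 he]
      exact ⟨h₀, hd.trans (Nat.le_succ _)⟩

/-- Here `l'` is what remains to be read from column `k` on. The length bound ensures that once it
is exhausted the column lies in the range where `rowTail` holds. -/
theorem gridInterp_rowConcept (l' : List (Set W)) (k : ℕ) (hk : l.length ≤ k + l'.length)
    (h : ∀ i, T (k + i) 0 ∈ l'.getD i B) :
    (k, 0) ∈ (rowConcept hN l').ext (gridInterp N l T) := by
  induction l' generalizing k with
  | nil => exact ⟨rfl, hk⟩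
  | cons s l' ih =>
    refine Concept.mem_ext_inf.2 ⟨gridInterp_tileIn.2 (h 0), (Concept.mem_ext_allRole hN).2 ?_⟩
    intro e he
    rw [(gridInterp_role hN).1 he]
    refine ih (k + 1) (by simp only [List.length_cons] at hk; omega) fun i => ?_
    have := h (i + 1)
    rwa [← add_assoc, add_right_comm] at this

end

/-- Choose one right and one upper successor of each grid point. Failure of `q'` makes the two maps
commute, and reading the tiles along their iterates gives the tiling. Values of successors not
chosen are irrelevant. -/
theorem exists_isTiling_of_isModel {I : Interp N 0} (hI : I.IsModel (tilingSchema hN H V B))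
    {l : List (Set W)} {d₀ : I.Dom} (h₀ : d₀ ∈ I.concept 0)
    (hrow : d₀ ∈ (rowConcept hN l).ext I)
    (hsq : ∀ x y z y' z', I.Role hN 0 x y → I.Role hN 1 y z → I.Role hN 1 x y' →
      I.Role hN 0 y' z' → z = z') : ∃ T, IsTiling H V l B T := by
  simp only [Interp.IsModel, tilingSchema, List.mem_cons, List.not_mem_nil, or_false,
    forall_eq_or_imp, forall_eq] at hI
  obtain ⟨hgrid, htail⟩ := hI
  have hgrid' (x : I.concept 0) :
      (∃ e : I.concept 0, I.Role hN 0 x e) ∧ (∃ e : I.concept 0, I.Role hN 1 x e) ∧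
      ∃ w : W, (∀ w', x.1 ∈ (tileConcept w').ext I ↔ w' = w) ∧
        (∀ e, I.Role hN 0 x e → e ∈ (tileIn {w' | H w w'}).ext I) ∧
        (∀ e, I.Role hN 1 x e → e ∈ (tileIn {w' | V w w'}).ext I) := by
    obtain ⟨hs, hw⟩ := Concept.mem_ext_inf.1 (hgrid x.2)
    obtain ⟨hs₁, hs₂⟩ := Concept.mem_ext_inf.1 hs
    obtain ⟨e₁, h₁, r₁⟩ := (Concept.mem_ext_someRole hN).1 hs₁
    obtain ⟨e₂, h₂, r₂⟩ := (Concept.mem_ext_someRole hN).1 hs₂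
    obtain ⟨C, hC, hw⟩ := Concept.mem_ext_unionList.1 hw
    obtain ⟨w, -, rfl⟩ := List.mem_map.1 hC
    obtain ⟨ho, hw⟩ := Concept.mem_ext_inf.1 hw
    obtain ⟨hh, hv⟩ := Concept.mem_ext_inf.1 hw
    exact ⟨⟨⟨e₁, h₁⟩, r₁⟩, ⟨⟨e₂, h₂⟩, r₂⟩, w, mem_ext_onlyTile.1 ho,
      (Concept.mem_ext_allRole hN).1 hh, (Concept.mem_ext_allRole hN).1 hv⟩
  choose right hright using fun x => (hgrid' x).1
  choose up hup using fun x => (hgrid' x).2.1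
  choose tile htile hH hV using fun x => (hgrid' x).2.2
  have tile_mem {x : I.concept 0} {s : Set W} (h : x.1 ∈ (tileIn s).ext I) : tile x ∈ s := by
    obtain ⟨w, hw, h⟩ := mem_ext_tileIn.1 h
    exact (htile x w).1 h ▸ hw
  have hcomm : Function.Commute up right := fun x =>
    Subtype.ext (hsq _ _ _ _ _ (hright x) (hup _) (hup x) (hright _))
  have hbottom (x : I.concept 0) (hx : x.1 ∈ (rowConcept hN l).ext I) (i : ℕ) :
      tile (right^[i] x) ∈ l.getD i B := by
    have htail' (i : ℕ) (x : I.concept 0) (hx : x.1 ∈ I.concept 1) : tile (right^[i] x) ∈ B := by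
      induction i generalizing x with
      | zero => exact tile_mem (Concept.mem_ext_inf.1 (htail hx)).1
      | succ i ih =>
        exact ih _ ((Concept.mem_ext_allRole hN).1 (Concept.mem_ext_inf.1 (htail hx)).2 _ (hright x))
    clear hrow
    induction l generalizing x i with
    | nil => exact htail' i x hx
    | cons s l ih =>
      obtain ⟨hs, hx⟩ := Concept.mem_ext_inf.1 hx
      cases i with
      | zero => exact tile_mem hs
      | succ i =>
        have := (Concept.mem_ext_allRole hN).1 hx _ (hright x)
        exact ih _ this i
  refine ⟨fun i j => tile (right^[i] (up^[j] ⟨d₀, h₀⟩)), fun i j => ?_, fun i j => ?_, fun i => ?_⟩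
  · rw [Function.iterate_succ_apply']
    exact tile_mem (hH _ _ (hright _))
  -- The extra upward step is innermost; commutation brings it outside, where vertical compatibility
  -- applies.
  · rw [Function.iterate_succ_apply', ← (hcomm.iterate_right i).eq]
    exact tile_mem (hV _ _ (hup _))
  · exact hbottom ⟨d₀, h₀⟩ hrow i

theorem tilingInstance_contained_iff (l : List (Set W)) :
    (tilingInstance hN H V B l).Contained ↔ ¬ ∃ T, IsTiling H V l B T := by
  constructor
  · rintro h ⟨T, hT⟩
    have hq : Fin.elim0 ∈ (originQuery hN l).ext (gridInterp N l T) :=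
      (mem_originQuery_ext hN).2 ⟨(0, 0), trivial,
        gridInterp_rowConcept hN (B := B) l 0 (by simp) (by simpa using hT.bottom)⟩
    obtain ⟨x, y, z, y', z', hxy, hyz, hxy', hyz', hne⟩ :=
      (mem_squareQuery_ext hN).1 (h _ (gridInterp_isModel hN hT) hq)
    cases (gridInterp_role hN).1 hxy
    cases (gridInterp_role hN).1 hyz
    cases (gridInterp_role hN).1 hxy'
    cases (gridInterp_role hN).1 hyz'
    exact hne rfl
  · intro h I hI o ho
    obtain ⟨d, hd, hrow⟩ := (mem_originQuery_ext hN).1 ho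
    by_contra hsq
    refine h (exists_isTiling_of_isModel hN hI hd hrow fun x y z y' z' h₁ h₂ h₃ h₄ => ?_)
    by_contra hne
    exact hsq ((mem_squareQuery_ext hN).2 ⟨x, y, z, y', z', h₁, h₂, h₃, h₄, hne⟩)

/-! ### Computability of the reduction -/

/-- Prepending a set to the row acts on Gödel numbers as a fixed composition of pairings with
constants, so `m` copies amount to primitive recursion on `m`. -/
theorem primrec_code_rowConcept (l : List (Set W)) (s : Set W) :
    Primrec fun m => (rowConcept (N := N) hN (l ++ List.replicate m s)).code := by
  have hstep (s : Set W) : ∃ g : ℕ → ℕ, Primrec g ∧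
      ∀ C : Concept N, (Concept.inf (tileIn s) (.allRole hN 0 C)).code = g C.code := by
    have pair (k : ℕ) {f : ℕ → ℕ} (hf : Primrec f) : Primrec fun x => Nat.pair k (f x) :=
      Primrec₂.natPair.comp (.const k) hf
    -- The constants are the constructor tags, arity and component indices met when `allRole` is
    -- unfolded, from the outside in.
    exact ⟨_, pair 3 <| pair (tileIn s).code <| pair 2 <| pair 5 <| pair 0 <| pair 4 <|
      pair (Rel.atom (binary hN) 0).code <| pair 2 <| pair 2 <| pair 1 <| pair 2 <| Primrec.id,
      fun C => rfl⟩
  induction l with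
  | nil =>
    obtain ⟨g, hg, hgC⟩ := hstep s
    refine (Primrec.nat_rec₁ (rowTail (N := N)).code (f := fun _ => g) (hg.comp .snd)).of_eq
      fun m => ?_
    induction m with
    | zero => rfl
    | succ m ih => exact (congrArg g ih).trans (hgC _).symm
  | cons s l ih =>
    obtain ⟨g, hg, hgC⟩ := hstep s
    exact (hg.comp ih).of_eq fun m => (hgC _).symm

variable (H V B)

theorem computable_code_tilingInstance (l : List (Set W)) (s : Set W) :
    Computable fun m => (tilingInstance hN H V B (l ++ List.replicate m s)).code := by
  have hq : Primrec fun m => (originQuery hN (l ++ List.replicate m s)).code := by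
    have h : Primrec fun m => Nat.pair 0 (Nat.pair
        (rowConcept (N := N) hN (l ++ List.replicate m s)).code (Nat.pair 1 0)) :=
      Primrec₂.natPair.comp (.const _)
        (Primrec₂.natPair.comp (primrec_code_rowConcept hN l s) (.const _))
    exact Primrec.encode.comp (Primrec.list_cons.comp (Primrec.list_cons.comp
      (.const (Atom.concept gridPoint (.var 0) : Atom N 0 0).code)
        (Primrec.list_cons.comp h (.const []))) (.const []))
  exact (Primrec.encode.comp (.pair (.const 0) (.pair
    (.const ((tilingSchema hN H V B).map Assertion.code)) (.pair (.const 0)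
      (.pair hq (.const (squareQuery hN).code)))))).to_comp

end Tiling

end DLR

-- A fixed machine with undecidable halting on unary-coded inputs

namespace DLR

open Turing

/-- Numbers are written in binary, least significant bit first. Powers of two are used as inputs
because their tapes are a block of equal symbols up to a fixed part. -/
theorem trNat_two_pow (m : ℕ) : PartrecToTM2.trNat (2 ^ m) =
    List.replicate m .bit0 ++ [.bit1] := by
  have (m : ℕ) : ∃ p : PosNum, ((2 ^ m : ℕ) : Num) = .pos p ∧
      PartrecToTM2.trPosNum p = List.replicate m .bit0 ++ [.bit1] := by
    induction m with
    | zero => exact ⟨.one, by rw [pow_zero, Nat.cast_one]; rfl, rfl⟩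
    | succ m ih =>
      obtain ⟨p, hp, ht⟩ := ih
      refine ⟨p.bit0, ?_, congrArg (List.cons PartrecToTM2.Γ'.bit0) ht⟩
      rw [pow_succ, mul_two, Nat.cast_add, hp, Num.bit0_of_bit0]
      rfl
  obtain ⟨p, hp, ht⟩ := this m
  rw [PartrecToTM2.trNat, hp, ← ht]
  rfl

/-- There are a Turing machine with finitely many states and symbols, and tapes consisting of a
fixed prefix and `m` copies of a fixed symbol, for which halting is not decidable. -/
theorem exists_machine_halting_undecidable :
    ∃ (Γ Λ : Type) (_ : Inhabited Γ) (_ : Inhabited Λ) (_ : Finite Γ) (M : TM0.Machine Γ Λ)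
      (S : Set Λ) (a b s : Γ), S.Finite ∧ TM0.Supports M S ∧
      ¬ ComputablePred fun m : ℕ => (TM0.eval M (a :: b :: List.replicate m s)).Dom := by
  -- Recovers `m` from `2 ^ m` by search, then runs the `m`-th program on 0: a universal function on
  -- inputs `2 ^ m`.
  let f : ℕ →. ℕ := fun x =>
    (Nat.rfind fun m => Part.some (decide (2 ^ m = x))).bind fun m =>
      (Denumerable.ofNat Nat.Partrec.Code m).eval 0
  have hf : Partrec f := by
    refine Partrec.bind (Partrec.rfind ?_) ?_
    · have : Primrec₂ fun x m : ℕ => decide (2 ^ m = x) := by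
        have hpow : Primrec fun m : ℕ => 2 ^ m :=
          (Primrec.nat_rec₁ 1 (f := fun _ k => 2 * k)
            (Primrec.nat_mul.comp (.const 2) .snd)).of_eq fun m => by
              induction m with
              | zero => rfl
              | succ m ih => exact (congrArg (2 * ·) ih).trans (pow_succ' 2 m).symm
        exact (Primrec.eq.comp (hpow.comp .snd) .fst).decide
      exact this.to_comp.partrec₂
    · exact (Nat.Partrec.Code.eval_part.comp ((Computable.ofNat _).comp .snd) (.const 0)).to₂
  have hdom (m : ℕ) : (f (2 ^ m)).Dom ↔ ((Denumerable.ofNat Nat.Partrec.Code m).eval 0).Dom := by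
    have : (Nat.rfind fun k => Part.some (decide (2 ^ k = 2 ^ m))) = Part.some m := by
      refine Part.eq_some_iff.2 (Nat.mem_rfind.2 ⟨by simp, fun {k} hk => ?_⟩)
      simpa using hk.ne
    simp only [f, this, Part.bind_some]
  obtain ⟨c, hc⟩ := ToPartrec.Code.exists_code (Nat.Partrec'.part_iff₁.2 hf)
  let M₂ : PartrecToTM2.Λ' → TM2.Stmt (fun _ : PartrecToTM2.K' => PartrecToTM2.Γ')
      PartrecToTM2.Λ' (Option PartrecToTM2.Γ') := PartrecToTM2.tr
  -- Machines start in the default label, so the default must be the entry point of the program `c`.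
  let _ : Inhabited PartrecToTM2.Λ' := ⟨PartrecToTM2.trNormal c .halt⟩
  have : Fintype PartrecToTM2.K' :=
    ⟨{.main, .rev, .aux, .stack}, fun k => by cases k <;> simp⟩
  have h₁ := TM2to1.tr_supports M₂ (PartrecToTM2.tr_supports c .halt)
  have h₀ := TM1to0.tr_supports (TM2to1.tr M₂) h₁
  -- A tape cell holding one level of all stacks: only `main` is nonempty initially, and the flag
  -- marks the bottom cell.
  let sym (d : Bool) (x : PartrecToTM2.Γ') : TM2to1.Γ' PartrecToTM2.K' (fun _ => PartrecToTM2.Γ') :=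
    (d, Function.update (fun _ => none) .main (some x))
  refine ⟨TM2to1.Γ' PartrecToTM2.K' fun _ => PartrecToTM2.Γ', _, inferInstance, inferInstance,
    inferInstance, TM1to0.tr (TM2to1.tr M₂), _, sym true .cons, sym false .bit1, sym false .bit0,
    Finset.finite_toSet _, h₀, fun hp => ?_⟩
  have key (m : ℕ) : (TM0.eval (TM1to0.tr (TM2to1.tr M₂))
      (sym true .cons :: sym false .bit1 :: List.replicate m (sym false .bit0))).Dom ↔
      ((Denumerable.ofNat Nat.Partrec.Code m).eval 0).Dom := by
    have hinit : sym true .cons :: sym false .bit1 :: List.replicate m (sym false .bit0) =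
        TM2to1.trInit .main (PartrecToTM2.trList [2 ^ m]) := by
      -- Stacks are stored bottom first, so the terminator and the leading bit become the fixed
      -- prefix.
      have hL : (PartrecToTM2.trList [2 ^ m]).reverse =
          .cons :: .bit1 :: List.replicate m .bit0 := by
        simp [PartrecToTM2.trList, trNat_two_pow]
      unfold TM2to1.trInit
      rw [hL]
      exact congrArg (fun L => sym true .cons :: sym false .bit1 :: L) List.map_replicate.symm
    rw [hinit, TM1to0.tr_eval, TM2to1.tr_eval_dom, ← hdom]
    have := PartrecToTM2.tr_eval c [2 ^ m]
    have hv := hc ⟨[2 ^ m], rfl⟩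
    rw [show ToPartrec.Code.eval c [2 ^ m] = pure <$> f (2 ^ m) from hv] at this
    have hstart : TM2.init .main (PartrecToTM2.trList [2 ^ m]) = PartrecToTM2.init c [2 ^ m] := by
      refine congrArg (TM2.Cfg.mk _ _) (funext fun k => ?_)
      cases k <;> rfl
    rw [← hstart] at this
    exact iff_of_eq (congrArg Part.Dom this)
  refine ComputablePred.halting_problem 0 ?_
  obtain ⟨_, hp⟩ := hp.of_eq key
  exact ⟨fun c => decidable_of_iff
    ((Denumerable.ofNat Nat.Partrec.Code (Encodable.encode c)).eval 0).Dom
    (by rw [Denumerable.ofNat_encode]), (hp.comp .encode).of_eq fun c => by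
      simp [Denumerable.ofNat_encode]⟩

end DLR

-- The reduction assembled

theorem theorem4p2 (N : ℕ) (hN : 2 ≤ N) :
    ¬ DLR.ContainmentDecidableOn (Set.univ : Set (DLR.Instance N)) ∧
      ¬ DLR.ContainmentDecidableOn {J : DLR.Instance N | J.Restricted} := by
  have h : ¬ DLR.ContainmentDecidableOn {J : DLR.Instance N | J.Restricted} := by
    rintro ⟨p, ⟨_, hp⟩, hpJ⟩
    obtain ⟨Γ, Λ, _, _, _, M, S, a, b, s, hS, hM, hund⟩ := DLR.exists_machine_halting_undecidable
    have := DLR.Tile.finite_state_mem (Γ := Γ) hS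
    have := Fintype.ofFinite {w : DLR.Tile Γ Λ // w.state ∈ S}
    let s' (a : Γ) : Set {w : DLR.Tile Γ Λ // w.state ∈ S} := Subtype.val ⁻¹' DLR.Tile.cell a
    let J (m : ℕ) := DLR.tilingInstance hN
      (fun w w' : {w : DLR.Tile Γ Λ // w.state ∈ S} => DLR.Tile.HCompat w.1 w'.1)
      (fun w w' => DLR.Tile.VCompat M w.1 w'.1) (s' default)
      ([Subtype.val ⁻¹' DLR.Tile.first a, s' b] ++ List.replicate m (s' s))
    -- Containment holds iff no tiling exists iff the machine halts, so `p` would decide halting.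
    have hJ (m : ℕ) : p (J m).code ↔ (Turing.TM0.eval M (a :: b :: List.replicate m s)).Dom := by
      rw [hpJ _ (DLR.tilingInstance_restricted ..), DLR.tilingInstance_contained_iff, not_iff_comm,
        ← DLR.Tile.exists_isTiling_iff hM]
      simp [s']
    refine hund (ComputablePred.of_eq ⟨fun m => inferInstance, ?_⟩ hJ)
    exact hp.comp (DLR.computable_code_tilingInstance hN _ _ _ _ _)
  -- A predicate correct on all inputs is in particular correct on the restricted ones.
  exact ⟨fun ⟨p, hp, hpJ⟩ => h ⟨p, hp, fun J _ => hpJ J trivial⟩, h⟩
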